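/- Let $q_0$ (top), $q_1$ (bottom left), $q_2$ (bottom right) be the vertices of an equilateral triangle of side length $1$ in the plane, $F_i(x)=\frac12(x+q_i)$, $V_0=\{q_0,q_1,q_2\}$, $V_{n+1}=\bigcup_i F_i(V_n)$, and let $SG=\overline{\bigcup_n V_n}$ be the Sierpinski gasket. Write $x\sim_n y$ if $x\ne y$ are both in $F_{w_1}\circ\dots\circ F_{w_n}(V_0)$ for some $w_1,\dots,w_n\in\{0,1,2\}$. For continuous $u:SG\to\mathbb R$ let $\mathcal E_n(u)=(5/3)^n\sum_{x\sim_n y}(u(x)-u(y))^2$ (sum over unordered pairs) and $\mathcal E(u)=\lim_{n\to\infty}\mathcal E_n(u)\in[0,\infty]$ (a nondecreasing limit); $\operatorname{dom}\mathcal E$ is the set of continuous $u$ with $\mathcal E(u)<\infty$. For $m\ge 1$ let $x_i=q_1+\frac{i}{2^m}(q_2-q_1)$, $0\le i\le 2^m$, be the bottom-row points of $V_m$. Given real numbers $t=(t_0,\dots,t_{2^m})$, put $$f_m=\sum_{i=0}^{2^m}t_i\,\chi_{[\frac{2i-1}{2^{m+1}},\frac{2i+1}{2^{m+1}}]\cap[0,1]},\qquad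 D^m_{n,k}=\int_0^1\Psi_{n,k}(s)f_m(s)\,ds,$$ where $\Psi_{n,k}$ equals $2^{n/2}$ on $[\frac{k}{2^n},\frac{k+1/2}{2^n})$, $-2^{n/2}$ on $(\frac{k+1/2}{2^n},\frac{k+1}{2^n}]$, and $0$ elsewhere. **Theorem.** There are real numbers $\gamma^m_n$ ($m\ge1$, $0\le n\le m$) with $$\gamma^1_0=20,\qquad \gamma^m_n=\tfrac{10}{3}\gamma^{m-1}_n\ \ (m\ge 2,\ 0\le n<m),\qquad \gamma^m_m=\frac{70\cdot 10^m}{5\cdot 3^m+16\cdot 10^m}\ \ (m\ge1),$$ such that for every $m\ge1$ and all real $t_0,\dots,t_{2^m}$ there is exactly one $u\in\operatorname{dom}\mathcal E$ that minimizes $\mathcal E$ among all functions in $\operatorname{dom}\mathcal E$ with values $t_i$ at $x_i$ ($0\le i\le 2^m$); this $u$ is harmonic away from the bottom row of $V_m$, that is, $\sum_{y\sim_n x}(u(y)-u(x))=0$ for all $n\ge m$ and all $x\in V_n\setminus\{x_0,\dots,x_{2^m}\}$; and $$\mathcal E(u)=\sum_{i=0}^{m}\gamma^m_i\sum_{j=0}^{2^{m-i}-1}\bigl(D^m_{m-i,j}\bigr)^2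 .$$ -/

import Mathlib

open MeasureTheory
open scoped ENNReal

noncomputable section

/-- The vertices of an equilateral triangle in the plane: `q₀` is the top vertex, `q₁` the bottom
left one and `q₂` the bottom right one. -/
def gasketCorner : Fin 3 → EuclideanSpace ℝ (Fin 2)
  | 0 => !₂[1 / 2, Real.sqrt 3 / 2]
  | 1 => !₂[0, 0]
  | 2 => !₂[1, 0]

/-- The contraction `F_i x = (x + q_i) / 2`. -/
def gasketMap (i : Fin 3) (x : EuclideanSpace ℝ (Fin 2)) : EuclideanSpace ℝ (Fin 2) :=
  (1 / 2 : ℝ) • (x + gasketCorner i)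

/-- `F_w = F_{w₁} ∘ F_{w₂} ∘ ⋯ ∘ F_{wₙ}` for a word `w = [w₁, …, wₙ]`. -/
def wordMap : List (Fin 3) → EuclideanSpace ℝ (Fin 2) → EuclideanSpace ℝ (Fin 2)
  | [] => id
  | i :: w => gasketMap i ∘ wordMap w

/-- `V_n = ⋃_{|w| = n} F_w {q₀, q₁, q₂}`, the vertices of the level `n` graph. -/
def gasketVertices (n : ℕ) : Set (EuclideanSpace ℝ (Fin 2)) :=
  {x | ∃ (w : Fin n → Fin 3) (i : Fin 3), x = wordMap (List.ofFn w) (gasketCorner i)}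

/-- The Sierpinski gasket: the closure of `⋃ n, V_n`, which is the compact attractor of
`F₀, F₁, F₂`. -/
def sierpinskiGasket : Set (EuclideanSpace ℝ (Fin 2)) :=
  closure (⋃ n, gasketVertices n)

theorem gasketVertices_subset (n : ℕ) : gasketVertices n ⊆ sierpinskiGasket :=
  (Set.subset_iUnion gasketVertices n).trans subset_closure

/-- The corner `F_w q_i` of the cell of the word `w`, as a point of the gasket. -/
def cellCorner {n : ℕ} (w : Fin n → Fin 3) (i : Fin 3) : sierpinskiGasket :=
  ⟨wordMap (List.ofFn w) (gasketCorner i), gasketVertices_subset n ⟨w, i, rfl⟩⟩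

/-- The renormalized graph energy `E_n(u) = (5/3)^n ∑_{x ∼ₙ y} (u x - u y)²`. Two vertices are
adjacent at level `n` when they are distinct corners of one cell of level `n`; each edge
belongs to exactly one such cell, so the sum over edges is the sum over the cells and over the
three pairs of corners of a cell. -/
def graphEnergy (n : ℕ) (u : sierpinskiGasket → ℝ) : ℝ :=
  (5 / 3 : ℝ) ^ n * ∑ w : Fin n → Fin 3,
    ((u (cellCorner w 0) - u (cellCorner w 1)) ^ 2
      + (u (cellCorner w 1) - u (cellCorner w 2)) ^ 2
      + (u (cellCorner w 2) - u (cellCorner w 0)) ^ 2)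

/-- The standard self-similar energy `E(u) = lim_n E_n(u) ∈ [0, ∞]`; the sequence `E_n(u)` is
nondecreasing, so the limit is the supremum. The domain of the energy consists of the continuous
functions for which this is finite. -/
def gasketEnergy (u : C(sierpinskiGasket, ℝ)) : ℝ≥0∞ :=
  ⨆ n, ENNReal.ofReal (graphEnergy n u)

open Classical in
/-- The graph Laplacian `Δ_n u(x) = ∑_{y ∼ₙ x} (u y - u x)`. Every neighbour `y` of `x` is a
corner, different from `x`, of exactly one cell of level `n` with corner `x`; the terms with
`y = x` vanish. -/
def graphLaplacian (n : ℕ) (u : sierpinskiGasket → ℝ) (x : sierpinskiGasket) : ℝ :=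
  ∑ w : Fin n → Fin 3, ∑ i : Fin 3, ∑ j : Fin 3,
    if cellCorner w i = x then u (cellCorner w j) - u x else 0

theorem bottom_mem_gasketVertices (m : ℕ) : ∀ k : ℕ, k ≤ 2 ^ m →
    (!₂[(k : ℝ) / 2 ^ m, 0] : EuclideanSpace ℝ (Fin 2)) ∈ gasketVertices m := by
  induction m with
  | zero =>
    intro k hk
    have hk' : k = 0 ∨ k = 1 := by
      simp only [pow_zero] at hk
      omega
    rcases hk' with rfl | rfl
    · exact ⟨Fin.elim0, 1, by simp [wordMap, gasketCorner]⟩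
    · exact ⟨Fin.elim0, 2, by simp [wordMap, gasketCorner]⟩
  | succ m ih =>
    intro k hk
    by_cases h : k ≤ 2 ^ m
    · obtain ⟨w, i, hw⟩ := ih k h
      refine ⟨Fin.cons 1 w, i, ?_⟩
      simp only [List.ofFn_succ, Fin.cons_zero, Fin.cons_succ, wordMap, Function.comp_apply]
      rw [← hw]
      simp only [gasketMap, gasketCorner]
      ext a
      fin_cases a
      · simp [pow_succ]
        ring
      · simp
    · have h2 : k - 2 ^ m ≤ 2 ^ m := by
        rw [pow_succ] at hk
        omega
      obtain ⟨w, i, hw⟩ := ih (k - 2 ^ m) h2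
      refine ⟨Fin.cons 2 w, i, ?_⟩
      simp only [List.ofFn_succ, Fin.cons_zero, Fin.cons_succ, wordMap, Function.comp_apply]
      rw [← hw]
      simp only [gasketMap, gasketCorner]
      have h3 : ((k - 2 ^ m : ℕ) : ℝ) = (k : ℝ) - 2 ^ m := by
        rw [Nat.cast_sub (by omega)]
        simp
      ext a
      fin_cases a
      · simp [pow_succ, h3]
        field_simp
        ring
      · simp

/-- The points `x_0, …, x_{2^m}` of the bottom row of `V_m`, from left to right. -/
def bottomPoint (m : ℕ) (k : Fin (2 ^ m + 1)) : sierpinskiGasket :=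
  ⟨!₂[(k : ℝ) / 2 ^ m, 0],
    gasketVertices_subset m (bottom_mem_gasketVertices m k (Nat.lt_succ_iff.mp k.isLt))⟩

/-- `u` is harmonic away from the bottom row of `V_m`: at every level `n ≥ m` the graph Laplacian
vanishes at all vertices of `V_n` off that row (at the top vertex `q₀`, with its two neighbours,
this is the vanishing of the normal derivative). -/
def IsHarmonicOffBottomRow (m : ℕ) (u : C(sierpinskiGasket, ℝ)) : Prop :=
  ∀ n, m ≤ n → ∀ x : sierpinskiGasket, (x : EuclideanSpace ℝ (Fin 2)) ∈ gasketVertices n →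
    x ∉ Set.range (bottomPoint m) → graphLaplacian n u x = 0

/-- `u` minimizes the energy among all functions in the domain of the energy that take the
values `t_0, …, t_{2^m}` on the bottom row of `V_m`. -/
structure IsBottomRowMinimizer (m : ℕ) (t : Fin (2 ^ m + 1) → ℝ) (u : C(sierpinskiGasket, ℝ)) :
    Prop where
  interpolates : ∀ k, u (bottomPoint m k) = t k
  finite_energy : gasketEnergy u < ∞
  minimal : ∀ v : C(sierpinskiGasket, ℝ), gasketEnergy v < ∞ →
    (∀ k, v (bottomPoint m k) = t k) → gasketEnergy u ≤ gasketEnergy v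

open Classical in
/-- The Haar function `Ψ_{n,k}`. -/
def haarFun (n k : ℕ) (x : ℝ) : ℝ :=
  if x ∈ Set.Ico ((k : ℝ) / 2 ^ n) ((k + 1 / 2 : ℝ) / 2 ^ n) then (2 : ℝ) ^ ((n : ℝ) / 2)
  else if x ∈ Set.Ioc ((k + 1 / 2 : ℝ) / 2 ^ n) ((k + 1 : ℝ) / 2 ^ n) then
    -(2 : ℝ) ^ ((n : ℝ) / 2)
  else 0

/-- The piecewise constant interpolation on `[0, 1]` of the values `t_0, …, t_{2^m}`: the sum of
the `t_i χ_{I_i}` with `I_i = [(2i - 1) / 2^(m+1), (2i + 1) / 2^(m+1)] ∩ [0, 1]`. -/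
def stepInterpolation (m : ℕ) (t : Fin (2 ^ m + 1) → ℝ) (x : ℝ) : ℝ :=
  ∑ i : Fin (2 ^ m + 1),
    (Set.Icc ((2 * (i : ℝ) - 1) / 2 ^ (m + 1)) ((2 * (i : ℝ) + 1) / 2 ^ (m + 1))
      ∩ Set.Icc 0 1).indicator (fun _ => t i) x

/-- The Haar coefficient `D^m_{n,k} = ⟨Ψ_{n,k}, f_m⟩` in `L²([0, 1])`. -/
def haarCoeff (m n k : ℕ) (t : Fin (2 ^ m + 1) → ℝ) : ℝ :=
  ∫ x in (0 : ℝ)..1, haarFun n k x * stepInterpolation m t x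

end

/-! Cutting the gasket into its three cells turns the minimization into a recursion on `m`. The
induction closes only if the value `z` at the top vertex is prescribed along with the row `T`: the
least energy is then `rowEnergy m T + topConductance m * (z - rowMean m T) ^ 2`. For level `m + 1`
the two lower cells contribute such expressions in the junction values `x`, `y`, the top cell
contributes at least the triangle energy of `z, x, y`, and completing the square in `x`, `y`
(`triangleEnergy_complete_square`) reproduces the same shape. What is left over is a multiple of the
squared difference of the means of the two half rows.

The bound holds for every function on the vertices (`rowEnergy_le_graphEnergy`) and is attained by
gluing harmonic pieces (`exists_energy_eq`). Uniqueness follows from the parallelogram identity,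
harmonicity from the first variation at one vertex. Unrolling the recursion gives a weighted sum of
squared differences of means over dyadic blocks, and these differences are the Haar coefficients up
to normalization (`haarCoeff_sq`). -/

/-! ### Geometry of the gasket: compactness, cells and junction points. -/

/-- The barycentric coordinates of a point of the plane with respect to the corners. -/
noncomputable def barycentric (x : EuclideanSpace ℝ (Fin 2)) : Fin 3 → ℝ
  | 0 => 2 * x 1 / Real.sqrt 3
  | 1 => 1 - x 0 - x 1 / Real.sqrt 3
  | 2 => x 0 - x 1 / Real.sqrt 3

theorem continuous_barycentric (i : Fin 3) : Continuous fun x => barycentric x i := by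
  fin_cases i <;> simp only [barycentric] <;> fun_prop

theorem sum_barycentric (x : EuclideanSpace ℝ (Fin 2)) : ∑ i, barycentric x i = 1 := by
  simp only [Fin.sum_univ_three, barycentric]
  ring

theorem barycentric_gasketCorner (i j : Fin 3) :
    barycentric (gasketCorner i) j = if i = j then 1 else 0 := by
  have h : Real.sqrt 3 ≠ 0 := by positivity
  fin_cases i <;> fin_cases j <;> simp [barycentric, gasketCorner] <;> field_simp <;> norm_num

theorem barycentric_gasketMap (i j : Fin 3) (x : EuclideanSpace ℝ (Fin 2)) :
    barycentric (gasketMap i x) j = (barycentric x j + if i = j then 1 else 0) / 2 := by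
  rw [← barycentric_gasketCorner i j]
  fin_cases j <;> simp [barycentric, gasketMap] <;> ring

theorem barycentric_injective : Function.Injective barycentric := by
  intro x y h
  have h3 : Real.sqrt 3 ≠ 0 := by positivity
  have h0 := congrFun h 0
  have h2 := congrFun h 2
  simp only [barycentric] at h0 h2
  have h1 : x 1 = y 1 := by
    field_simp at h0
    linarith
  rw [h1] at h2
  ext a
  fin_cases a
  · simpa using h2
  · simpa using h1

theorem barycentric_wordMap_nonneg (l : List (Fin 3)) (i j : Fin 3) :
    0 ≤ barycentric (wordMap l (gasketCorner i)) j := by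
  induction l with
  | nil =>
    simp only [wordMap, id, barycentric_gasketCorner]
    split_ifs <;> norm_num
  | cons k l ih =>
    simp only [wordMap, Function.comp_apply, barycentric_gasketMap]
    split_ifs <;> linarith

theorem barycentric_nonneg {x : EuclideanSpace ℝ (Fin 2)} (hx : x ∈ sierpinskiGasket)
    (j : Fin 3) : 0 ≤ barycentric x j := by
  have hcl : IsClosed {y | 0 ≤ barycentric y j} :=
    isClosed_le continuous_const (continuous_barycentric j)
  refine closure_minimal ?_ hcl hx
  refine Set.iUnion_subset fun n => ?_
  rintro _ ⟨w, i, rfl⟩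
  exact barycentric_wordMap_nonneg _ i j

theorem eq_gasketCorner_of_one_le {x : EuclideanSpace ℝ (Fin 2)} (hx : x ∈ sierpinskiGasket)
    {i : Fin 3} (h : 1 ≤ barycentric x i) : x = gasketCorner i := by
  apply barycentric_injective
  have hs := sum_barycentric x
  have hn := barycentric_nonneg hx
  rw [Fin.sum_univ_three] at hs
  have h0 := hn 0
  have h1 := hn 1
  have h2 := hn 2
  funext j
  rw [barycentric_gasketCorner]
  fin_cases i <;> fin_cases j <;> simp at h ⊢ <;> linarith

theorem isCompact_sierpinskiGasket : IsCompact sierpinskiGasket := by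
  refine Metric.isCompact_of_isClosed_isBounded isClosed_closure ?_
  refine (Metric.isBounded_closedBall (x := (0 : EuclideanSpace ℝ (Fin 2))) (r := 2)).subset ?_
  intro x hx
  have h3 : (0 : ℝ) < Real.sqrt 3 := by positivity
  have h3' : Real.sqrt 3 ≤ 2 := Real.sqrt_le_iff.2 (by norm_num)
  have h0 := barycentric_nonneg hx 0
  have h1 := barycentric_nonneg hx 1
  have h2 := barycentric_nonneg hx 2
  simp only [barycentric] at h0 h1 h2
  have e : 2 * x 1 / Real.sqrt 3 = 2 * (x 1 / Real.sqrt 3) := by ring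
  have hx1 : x 1 = (x 1 / Real.sqrt 3) * Real.sqrt 3 := by field_simp
  set s := x 1 / Real.sqrt 3
  have hs0 : 0 ≤ s := by linarith
  have hs1 : s ≤ 1 / 2 := by linarith
  have hx1' : x 1 ≤ 1 := by nlinarith
  have hx1'' : 0 ≤ x 1 := by rw [hx1]; positivity
  rw [mem_closedBall_zero_iff, EuclideanSpace.norm_eq, Real.sqrt_le_iff, Fin.sum_univ_two]
  refine ⟨by norm_num, ?_⟩
  simp only [Real.norm_eq_abs, sq_abs]
  nlinarith

instance : CompactSpace sierpinskiGasket :=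
  isCompact_iff_compactSpace.1 isCompact_sierpinskiGasket

theorem continuous_gasketMap (i : Fin 3) : Continuous (gasketMap i) := by
  unfold gasketMap
  fun_prop

theorem gasketMap_mem (i : Fin 3) {x : EuclideanSpace ℝ (Fin 2)} (hx : x ∈ sierpinskiGasket) :
    gasketMap i x ∈ sierpinskiGasket := by
  refine map_mem_closure (continuous_gasketMap i) hx ?_
  intro y hy
  obtain ⟨n, w, j, rfl⟩ := Set.mem_iUnion.1 hy
  refine Set.mem_iUnion.2 ⟨n + 1, Fin.cons i w, j, ?_⟩
  simp [List.ofFn_succ, wordMap]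

/-- The contraction `F_i` as a map of the gasket to itself. -/
noncomputable def cellMap (i : Fin 3) (x : sierpinskiGasket) : sierpinskiGasket :=
  ⟨gasketMap i x, gasketMap_mem i x.2⟩

/-- The corner `q_i` as a point of the gasket. -/
noncomputable def corner (i : Fin 3) : sierpinskiGasket := cellCorner (n := 0) Fin.elim0 i

theorem coe_corner (i : Fin 3) : (corner i : EuclideanSpace ℝ (Fin 2)) = gasketCorner i := by
  simp [corner, cellCorner, wordMap]

theorem continuous_cellMap (i : Fin 3) : Continuous (cellMap i) :=
  ((continuous_gasketMap i).comp continuous_subtype_val).subtype_mk _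

theorem cellCorner_cons {n : ℕ} (i : Fin 3) (w : Fin n → Fin 3) (j : Fin 3) :
    cellCorner (Fin.cons i w : Fin (n + 1) → Fin 3) j = cellMap i (cellCorner w j) := by
  apply Subtype.ext
  simp [cellCorner, cellMap, List.ofFn_succ, wordMap]

theorem cellMap_corner_comm (i j : Fin 3) : cellMap i (corner j) = cellMap j (corner i) := by
  apply Subtype.ext
  simp only [cellMap, coe_corner, gasketMap]
  rw [add_comm]

theorem cellMap_corner_self (i : Fin 3) : cellMap i (corner i) = corner i := by
  apply Subtype.ext
  simp only [cellMap, coe_corner, gasketMap]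
  rw [← two_smul ℝ, smul_smul]
  norm_num

/-- The three image cells are compact, so their union is closed; it contains every vertex, hence the
closure. -/
theorem exists_cellMap_eq (y : sierpinskiGasket) : ∃ i x, cellMap i x = y := by
  have hcl : IsClosed (⋃ i, gasketMap i '' sierpinskiGasket) :=
    isClosed_iUnion_of_finite fun i =>
      (isCompact_sierpinskiGasket.image (continuous_gasketMap i)).isClosed
  have hsub : sierpinskiGasket ⊆ ⋃ i, gasketMap i '' sierpinskiGasket := by
    refine closure_minimal (Set.iUnion_subset fun n => ?_) hcl
    rintro _ ⟨w, j, rfl⟩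
    cases n with
    | zero =>
      refine Set.mem_iUnion.2 ⟨j, corner j, (corner j).2, ?_⟩
      have h := congrArg Subtype.val (cellMap_corner_self j)
      rw [coe_corner] at h
      simpa [wordMap, cellMap] using h
    | succ n =>
      refine Set.mem_iUnion.2 ⟨w 0, (cellCorner (fun k => w k.succ) j),
        (cellCorner (fun k => w k.succ) j).2, ?_⟩
      simp [cellCorner, List.ofFn_succ, wordMap]
  obtain ⟨i, x, hx, h⟩ := Set.mem_iUnion.1 (hsub y.2)
  exact ⟨i, ⟨x, hx⟩, Subtype.ext h⟩

theorem cellMap_injective (i : Fin 3) : Function.Injective (cellMap i) := by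
  intro x y h
  have h' := congrArg Subtype.val h
  simp only [cellMap, gasketMap] at h'
  have h2 := smul_right_injective _ (by norm_num : (1 / 2 : ℝ) ≠ 0) h'
  exact Subtype.ext (add_right_cancel h2)

/-- In the cell `i` the `i`-th barycentric coordinate is at least 1/2, while in the cell `j` it is
half that of `y`; so `y` has `i`-th coordinate at least 1. Distinct cells thus meet only at junction
points, which is what gluing needs. -/
theorem eq_corner_of_cellMap_eq {i j : Fin 3} (hij : i ≠ j) {x y : sierpinskiGasket}
    (h : cellMap i x = cellMap j y) : y = corner i := by
  apply Subtype.ext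
  rw [coe_corner]
  apply eq_gasketCorner_of_one_le y.2
  have h' := congrArg (fun z : sierpinskiGasket => barycentric z i) h
  simp only [cellMap, barycentric_gasketMap, if_true, if_neg hij.symm] at h'
  have := barycentric_nonneg x.2 i
  linarith

/-! ### Gluing and harmonic extension. -/

/-- Three continuous functions on the gasket that agree at the junction points come from one
continuous function on the cells of level one. -/
theorem exists_glue (g : Fin 3 → C(sierpinskiGasket, ℝ))
    (hg : ∀ i j, g i (corner j) = g j (corner i)) :
    ∃ u : C(sierpinskiGasket, ℝ), ∀ i x, u (cellMap i x) = g i x := by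
  let p : C(Fin 3 × sierpinskiGasket, sierpinskiGasket) :=
    ⟨fun z => cellMap z.1 z.2, continuous_prod_of_discrete_left.2 continuous_cellMap⟩
  let q : C(Fin 3 × sierpinskiGasket, ℝ) :=
    ⟨fun z => g z.1 z.2, continuous_prod_of_discrete_left.2 fun i => (g i).continuous⟩
  have hs : Function.Surjective p := fun y => by
    obtain ⟨i, x, h⟩ := exists_cellMap_eq y
    exact ⟨(i, x), h⟩
  -- A continuous map from a compact space to a Hausdorff space is closed, and a closed continuous
  -- surjection is a quotient map.
  have hp : Topology.IsQuotientMap p := p.continuous.isClosedMap.isQuotientMap p.continuous hs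
  have hf : Function.FactorsThrough q p := by
    rintro ⟨i, x⟩ ⟨j, y⟩ h
    change cellMap i x = cellMap j y at h
    change g i x = g j y
    by_cases hij : i = j
    · subst hij
      rw [cellMap_injective i h]
    · rw [eq_corner_of_cellMap_eq hij h, eq_corner_of_cellMap_eq (Ne.symm hij) h.symm, hg]
  refine ⟨hp.lift q hf, fun i x => ?_⟩
  exact congrArg (fun r : C(Fin 3 × sierpinskiGasket, ℝ) => r (i, x)) (hp.lift_comp q hf)

/-- The values at the corners of the cell `F_i` of the harmonic function with boundary values
`a`. -/
noncomputable def harmonicStep (i : Fin 3) (a : Fin 3 → ℝ) (j : Fin 3) : ℝ :=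
  if i = j then a i else (a 0 + a 1 + a 2 + a i + a j) / 5

theorem harmonicStep_comm (i j : Fin 3) (a : Fin 3 → ℝ) :
    harmonicStep i a j = harmonicStep j a i := by
  by_cases h : i = j
  · rw [h]
  · simp only [harmonicStep, if_neg h, if_neg (Ne.symm h)]
    ring

/-- The affine function with the values `a` at the corners, restricted to the gasket. -/
noncomputable def affineInterpolation (a : Fin 3 → ℝ) : C(sierpinskiGasket, ℝ) :=
  ⟨fun x => ∑ i, a i * barycentric x i, by
    have := fun i => (continuous_barycentric i).comp
      (continuous_subtype_val (p := (· ∈ sierpinskiGasket)))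
    exact continuous_finsetSum _ fun i _ => continuous_const.mul (this i)⟩

open Classical in
/-- The continuous function with prescribed restrictions to the three cells of level one
(zero if these do not match). -/
noncomputable def glue (g : Fin 3 → C(sierpinskiGasket, ℝ)) : C(sierpinskiGasket, ℝ) :=
  if h : ∀ i j, g i (corner j) = g j (corner i) then (exists_glue g h).choose else 0

theorem glue_cellMap {g : Fin 3 → C(sierpinskiGasket, ℝ)}
    (h : ∀ i j, g i (corner j) = g j (corner i)) (i : Fin 3) (x : sierpinskiGasket) :
    glue g (cellMap i x) = g i x := by
  rw [glue, dif_pos h]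
  exact (exists_glue g h).choose_spec i x

/-- The function that follows the harmonic extension rule up to level `n` and is affine on the
cells of level `n`. -/
noncomputable def harmonicApprox : ℕ → (Fin 3 → ℝ) → C(sierpinskiGasket, ℝ)
  | 0, a => affineInterpolation a
  | n + 1, a => glue fun i => harmonicApprox n (harmonicStep i a)

/-- The two claims depend on each other: `glue` is meaningful at level `n + 1` only once the corner
values at level `n` are known to match, and those values come from the gluing rule one level below.
-/
theorem harmonicApprox_aux (n : ℕ) :
    (∀ a i, harmonicApprox n a (corner i) = a i) ∧
    ∀ a i x, harmonicApprox (n + 1) a (cellMap i x) = harmonicApprox n (harmonicStep i a) x := by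
  have key : ∀ n, (∀ a i, harmonicApprox n a (corner i) = a i) →
      ∀ a i x, harmonicApprox (n + 1) a (cellMap i x) = harmonicApprox n (harmonicStep i a) x := by
    intro n h a i x
    refine glue_cellMap (g := fun i => harmonicApprox n (harmonicStep i a)) ?_ i x
    intro i j
    rw [h, h, harmonicStep_comm]
  have hc : ∀ n a i, harmonicApprox n a (corner i) = a i := by
    intro n
    induction n with
    | zero =>
      intro a i
      simp [harmonicApprox, affineInterpolation, coe_corner, barycentric_gasketCorner]
    | succ n ih =>
      intro a i
      rw [← cellMap_corner_self, key n ih, ih]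
      simp [harmonicStep]
  exact ⟨hc n, key n (hc n)⟩

theorem harmonicApprox_corner (n : ℕ) (a : Fin 3 → ℝ) (i : Fin 3) :
    harmonicApprox n a (corner i) = a i := (harmonicApprox_aux n).1 a i

theorem harmonicApprox_cellMap (n : ℕ) (a : Fin 3 → ℝ) (i : Fin 3) (x : sierpinskiGasket) :
    harmonicApprox (n + 1) a (cellMap i x) = harmonicApprox n (harmonicStep i a) x :=
  (harmonicApprox_aux n).2 a i x

theorem affineInterpolation_mem_Icc {a : Fin 3 → ℝ} {lo hi : ℝ} (ha : ∀ i, a i ∈ Set.Icc lo hi)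
    (x : sierpinskiGasket) : affineInterpolation a x ∈ Set.Icc lo hi := by
  have hs := sum_barycentric x
  have hn := barycentric_nonneg x.2
  constructor
  · calc lo = ∑ i, lo * barycentric x i := by rw [← Finset.mul_sum, hs, mul_one]
      _ ≤ ∑ i, a i * barycentric x i :=
        Finset.sum_le_sum fun i _ => mul_le_mul_of_nonneg_right (ha i).1 (hn i)
  · calc ∑ i, a i * barycentric x i ≤ ∑ i, hi * barycentric x i :=
        Finset.sum_le_sum fun i _ => mul_le_mul_of_nonneg_right (ha i).2 (hn i)
      _ = hi := by rw [← Finset.mul_sum, hs, mul_one]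

/-- Every new value is `2 / 5 * a i` plus values of total weight 3/5. The range therefore shrinks by
3/5 per level, which makes the approximations converge uniformly. -/
theorem harmonicStep_mem_Icc {a : Fin 3 → ℝ} {lo hi : ℝ} (ha : ∀ i, a i ∈ Set.Icc lo hi)
    (i j : Fin 3) :
    harmonicStep i a j ∈ Set.Icc (2 / 5 * a i + 3 / 5 * lo) (2 / 5 * a i + 3 / 5 * hi) := by
  have h0 := ha 0
  have h1 := ha 1
  have h2 := ha 2
  simp only [Set.mem_Icc] at *
  fin_cases i <;> fin_cases j <;> simp [harmonicStep] <;> constructor <;> linarith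

theorem harmonicApprox_succ_sub_le (n : ℕ) : ∀ (a : Fin 3 → ℝ) (lo hi : ℝ),
    (∀ i, a i ∈ Set.Icc lo hi) → ∀ x,
      |harmonicApprox n a x - harmonicApprox (n + 1) a x| ≤ (hi - lo) * (3 / 5) ^ n := by
  induction n with
  | zero =>
    intro a lo hi ha x
    obtain ⟨i, y, rfl⟩ := exists_cellMap_eq x
    rw [harmonicApprox_cellMap]
    have h1 := affineInterpolation_mem_Icc ha (cellMap i y)
    have h2 := affineInterpolation_mem_Icc (a := harmonicStep i a) (lo := lo) (hi := hi)
      (fun j => by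
        have := harmonicStep_mem_Icc ha i j
        have h3 := ha i
        simp only [Set.mem_Icc] at *
        constructor <;> linarith) y
    simp only [harmonicApprox, Set.mem_Icc] at *
    rw [abs_le]
    constructor <;> linarith
  | succ n ih =>
    intro a lo hi ha x
    obtain ⟨i, y, rfl⟩ := exists_cellMap_eq x
    rw [harmonicApprox_cellMap, harmonicApprox_cellMap]
    refine (ih _ _ _ (harmonicStep_mem_Icc ha i) y).trans (le_of_eq ?_)
    ring

/-- Harmonic functions with arbitrary boundary values exist. -/
theorem exists_harmonic : ∃ H : (Fin 3 → ℝ) → C(sierpinskiGasket, ℝ),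
    (∀ a i, H a (corner i) = a i) ∧
    ∀ a i x, H a (cellMap i x) = H (harmonicStep i a) x := by
  have hC : ∀ a, ∃ u, Filter.Tendsto (fun n => harmonicApprox n a) Filter.atTop (nhds u) := by
    intro a
    have hb : ∀ i, a i ∈ Set.Icc (-∑ i, |a i|) (∑ i, |a i|) := fun i =>
      abs_le.1 (Finset.single_le_sum (fun j _ => abs_nonneg (a j)) (Finset.mem_univ i))
    refine cauchySeq_tendsto_of_complete
      (cauchySeq_of_le_geometric (3 / 5) (∑ i, |a i| - -∑ i, |a i|) (by norm_num) fun n => ?_)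
    rw [ContinuousMap.dist_le (by
      have : 0 ≤ ∑ i, |a i| := Finset.sum_nonneg fun i _ => abs_nonneg _
      rw [sub_neg_eq_add]
      positivity)]
    exact fun x => harmonicApprox_succ_sub_le n a _ _ hb x
  choose H hH using hC
  have hpt : ∀ a x, Filter.Tendsto (fun n => harmonicApprox n a x) Filter.atTop (nhds (H a x)) :=
    fun a x => ((continuous_eval_const x).tendsto _).comp (hH a)
  refine ⟨H, fun a i => ?_, fun a i x => ?_⟩
  · refine tendsto_nhds_unique (hpt a _) ?_
    simp only [harmonicApprox_corner]
    exact tendsto_const_nhds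
  · refine tendsto_nhds_unique ((hpt a (cellMap i x)).comp (Filter.tendsto_add_atTop_nat 1)) ?_
    simp only [Function.comp_def, harmonicApprox_cellMap]
    exact hpt _ x

/-! ### Graph energies and their monotonicity. -/

/-- The energy of the values at the three corners of a triangle. -/
noncomputable def triangleEnergy (a b c : ℝ) : ℝ := (a - b) ^ 2 + (b - c) ^ 2 + (c - a) ^ 2

theorem graphEnergy_zero (u : sierpinskiGasket → ℝ) :
    graphEnergy 0 u = triangleEnergy (u (corner 0)) (u (corner 1)) (u (corner 2)) := by
  simp only [graphEnergy, pow_zero, one_mul, Fintype.sum_unique, triangleEnergy, corner]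
  rfl

theorem graphEnergy_succ (n : ℕ) (u : sierpinskiGasket → ℝ) :
    graphEnergy (n + 1) u = 5 / 3 * ∑ i, graphEnergy n (u ∘ cellMap i) := by
  simp only [graphEnergy]
  rw [← (Fin.consEquiv fun _ : Fin (n + 1) => Fin 3).sum_comp, Fintype.sum_prod_type,
    ← Finset.mul_sum, pow_succ]
  have e : ∀ (i : Fin 3) (w : Fin n → Fin 3),
      (Fin.consEquiv fun _ : Fin (n + 1) => Fin 3) (i, w) = Fin.cons i w := fun _ _ => rfl
  simp only [e, cellCorner_cons, Function.comp_apply]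
  ring

theorem graphEnergy_nonneg (n : ℕ) (u : sierpinskiGasket → ℝ) : 0 ≤ graphEnergy n u := by
  unfold graphEnergy
  positivity

/-- The factor 5/3 is the one for which minimizing over the three junction values returns the
level-zero energy. -/
theorem graphEnergy_zero_le_one (u : sierpinskiGasket → ℝ) :
    graphEnergy 0 u ≤ graphEnergy 1 u := by
  rw [graphEnergy_succ]
  simp only [graphEnergy_zero, Fin.sum_univ_three, Function.comp_apply, cellMap_corner_self]
  rw [cellMap_corner_comm 1 0, cellMap_corner_comm 2 0, cellMap_corner_comm 2 1]
  generalize u (corner 0) = a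
  generalize u (corner 1) = b
  generalize u (corner 2) = c
  generalize u (cellMap 0 (corner 1)) = x
  generalize u (cellMap 0 (corner 2)) = y
  generalize u (cellMap 1 (corner 2)) = z
  simp only [triangleEnergy]
  -- All four squares vanish exactly at the harmonic values of `x`, `y`, `z`.
  nlinarith [sq_nonneg (x + y + z - (a + b + c)),
    sq_nonneg (x - y - (b - c) / 5), sq_nonneg (y - z - (a - b) / 5),
    sq_nonneg (x - z - (a - c) / 5)]

theorem graphEnergy_le_succ (n : ℕ) (u : sierpinskiGasket → ℝ) :
    graphEnergy n u ≤ graphEnergy (n + 1) u := by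
  induction n generalizing u with
  | zero => exact graphEnergy_zero_le_one u
  | succ n ih =>
    rw [graphEnergy_succ, graphEnergy_succ (n + 1)]
    exact mul_le_mul_of_nonneg_left (Finset.sum_le_sum fun i _ => ih _) (by norm_num)

theorem graphEnergy_mono (u : sierpinskiGasket → ℝ) : Monotone fun n => graphEnergy n u :=
  monotone_nat_of_le_succ fun n => graphEnergy_le_succ n u

theorem exists_harmonic_energy (a : Fin 3 → ℝ) :
    ∃ u : C(sierpinskiGasket, ℝ), (∀ i, u (corner i) = a i) ∧
      ∀ n, graphEnergy n u = triangleEnergy (a 0) (a 1) (a 2) := by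
  obtain ⟨H, hc, hH⟩ := exists_harmonic
  refine ⟨H a, hc a, fun n => ?_⟩
  induction n generalizing a with
  | zero => rw [graphEnergy_zero, hc, hc, hc]
  | succ n ih =>
    have h : ∀ i, (H a) ∘ cellMap i = H (harmonicStep i a) := fun i => funext fun x => hH a i x
    rw [graphEnergy_succ]
    simp only [h, ih, Fin.sum_univ_three, triangleEnergy, harmonicStep]
    simp
    ring

/-! ### Self-similarity of the bottom row. -/

theorem bottomPoint_zero_left : bottomPoint 0 0 = corner 1 := by
  apply Subtype.ext
  rw [coe_corner]
  simp [bottomPoint, gasketCorner]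

theorem bottomPoint_zero_right : bottomPoint 0 1 = corner 2 := by
  apply Subtype.ext
  rw [coe_corner]
  simp [bottomPoint, gasketCorner]

theorem bottomPoint_first (m : ℕ) : bottomPoint m 0 = corner 1 := by
  apply Subtype.ext
  rw [coe_corner]
  simp [bottomPoint, gasketCorner]

theorem bottomPoint_last (m : ℕ) : bottomPoint m (Fin.last _) = corner 2 := by
  apply Subtype.ext
  rw [coe_corner]
  simp [bottomPoint, gasketCorner]

theorem cellMap_one_bottomPoint (m : ℕ) (k : Fin (2 ^ m + 1)) (h : (k : ℕ) < 2 ^ (m + 1) + 1) :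
    cellMap 1 (bottomPoint m k) = bottomPoint (m + 1) ⟨k, h⟩ := by
  apply Subtype.ext
  simp only [bottomPoint, cellMap, gasketMap, gasketCorner]
  ext a
  fin_cases a
  · simp [pow_succ]
    ring
  · simp

theorem cellMap_two_bottomPoint (m : ℕ) (k : Fin (2 ^ m + 1))
    (h : (k : ℕ) + 2 ^ m < 2 ^ (m + 1) + 1) :
    cellMap 2 (bottomPoint m k) = bottomPoint (m + 1) ⟨k + 2 ^ m, h⟩ := by
  apply Subtype.ext
  simp only [bottomPoint, cellMap, gasketMap, gasketCorner]
  ext a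
  fin_cases a
  · simp [pow_succ]
    field_simp
  · simp

theorem bottomPoint_succ_cases (m : ℕ) (k : Fin (2 ^ (m + 1) + 1)) :
    (∃ j : Fin (2 ^ m + 1), (j : ℕ) = k ∧ bottomPoint (m + 1) k = cellMap 1 (bottomPoint m j)) ∨
    ∃ j : Fin (2 ^ m + 1), (j : ℕ) + 2 ^ m = k ∧
      bottomPoint (m + 1) k = cellMap 2 (bottomPoint m j) := by
  have hk : (k : ℕ) < 2 ^ m * 2 + 1 := pow_succ 2 m ▸ k.2
  by_cases h : (k : ℕ) < 2 ^ m + 1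
  · exact Or.inl ⟨⟨k, h⟩, rfl, (cellMap_one_bottomPoint m ⟨k, h⟩ k.2).symm⟩
  · have e : (k : ℕ) - 2 ^ m + 2 ^ m = k := by omega
    refine Or.inr ⟨⟨k - 2 ^ m, by omega⟩, e, ?_⟩
    rw [cellMap_two_bottomPoint m _ (by simp only [e]; exact k.2)]
    congr 1
    exact Fin.ext e.symm

/-- `T` gives the values of `u` on the bottom row of `V_m`. -/
def HasBottomRow (m : ℕ) (T : ℕ → ℝ) (u : sierpinskiGasket → ℝ) : Prop :=
  ∀ k : Fin (2 ^ m + 1), u (bottomPoint m k) = T k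

/-- The two half rows share the index `2 ^ m`. Indexing the data by all of `ℕ` makes the right half
a plain shift. -/
theorem hasBottomRow_succ {m : ℕ} {T : ℕ → ℝ} {u : sierpinskiGasket → ℝ} :
    HasBottomRow (m + 1) T u ↔
      HasBottomRow m T (u ∘ cellMap 1) ∧
        HasBottomRow m (fun k => T (k + 2 ^ m)) (u ∘ cellMap 2) := by
  constructor
  · intro h
    refine ⟨fun k => ?_, fun k => ?_⟩
    · have hk : (k : ℕ) < 2 ^ (m + 1) + 1 := by
        have := k.2
        rw [pow_succ]
        omega
      rw [Function.comp_apply, cellMap_one_bottomPoint m k hk, h]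
    · have hk : (k : ℕ) + 2 ^ m < 2 ^ (m + 1) + 1 := by
        have := k.2
        rw [pow_succ]
        omega
      rw [Function.comp_apply, cellMap_two_bottomPoint m k hk, h]
  · rintro ⟨h1, h2⟩ k
    rcases bottomPoint_succ_cases m k with ⟨j, hj, e⟩ | ⟨j, hj, e⟩
    · rw [e, ← hj]
      exact h1 j
    · rw [e, ← hj]
      exact h2 j

/-! ### Least energy for given values on a row. -/

/-- The conductance between the top vertex and the bottom row of `V_m`. -/
noncomputable def topConductance : ℕ → ℝ
  | 0 => 2
  | m + 1 => 10 / 3 * topConductance m / (1 + topConductance m)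

/-- The trapezoidal mean of the values on the bottom row of `V_m`. -/
noncomputable def rowMean : ℕ → (ℕ → ℝ) → ℝ
  | 0, T => (T 0 + T 1) / 2
  | m + 1, T => (rowMean m T + rowMean m fun k => T (k + 2 ^ m)) / 2

/-- The least energy of a function with given values on the bottom row of `V_m`. -/
noncomputable def rowEnergy : ℕ → (ℕ → ℝ) → ℝ
  | 0, T => 3 / 2 * (T 0 - T 1) ^ 2
  | m + 1, T => 5 / 3 * (rowEnergy m T + rowEnergy m (fun k => T (k + 2 ^ m))
      + 3 * topConductance m / (6 + 2 * topConductance m)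
        * (rowMean m T - rowMean m fun k => T (k + 2 ^ m)) ^ 2)

theorem topConductance_pos (m : ℕ) : 0 < topConductance m := by
  induction m with
  | zero => norm_num [topConductance]
  | succ m ih =>
    rw [topConductance]
    positivity

theorem rowEnergy_nonneg (m : ℕ) (T : ℕ → ℝ) : 0 ≤ rowEnergy m T := by
  induction m generalizing T with
  | zero =>
    rw [rowEnergy]
    positivity
  | succ m ih =>
    have := topConductance_pos m
    have h1 := ih T
    have h2 := ih fun k => T (k + 2 ^ m)
    rw [rowEnergy]
    positivity

/-- Completing the square in the values `x`, `y` at the two upper junction points. -/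
theorem triangleEnergy_complete_square {c : ℝ} (hc : 0 < c) (p q x y z : ℝ) :
    triangleEnergy z x y + c * (x - p) ^ 2 + c * (y - q) ^ 2 =
      3 * c / (6 + 2 * c) * (p - q) ^ 2 + 2 * c / (1 + c) * (z - (p + q) / 2) ^ 2
      + (c + 1) / 2 * (x + y - (c * (p + q) + 2 * z) / (c + 1)) ^ 2
      + (c + 3) / 2 * (x - y - c * (p - q) / (c + 3)) ^ 2 := by
  have h1 : c + 1 ≠ 0 := by positivity
  have h2 : c + 3 ≠ 0 := by positivity
  have e1 : 1 + c = c + 1 := by ring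
  have e2 : 6 + 2 * c = 2 * (c + 3) := by ring
  rw [triangleEnergy, e1, e2]
  field_simp
  ring

/-- The term in the top value lets the induction close: the hypothesis applies to both lower cells,
the top cell is bounded by its level-zero energy, and the two squares containing the junction values
are dropped. Continuity is not needed, so the bound also covers perturbations at a single vertex. -/
theorem rowEnergy_le_graphEnergy (m : ℕ) : ∀ (n : ℕ), m ≤ n → ∀ (T : ℕ → ℝ)
    (u : sierpinskiGasket → ℝ), HasBottomRow m T u →
      rowEnergy m T + topConductance m * (u (corner 0) - rowMean m T) ^ 2 ≤ graphEnergy n u := by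
  induction m with
  | zero =>
    intro n _ T u hu
    refine le_trans (le_of_eq ?_) (graphEnergy_mono u (Nat.zero_le n))
    have h0 := hu 0
    have h1 := hu 1
    rw [bottomPoint_zero_left] at h0
    rw [bottomPoint_zero_right] at h1
    simp only [graphEnergy_zero, h0, h1, rowEnergy, topConductance, rowMean, triangleEnergy]
    simp
    ring
  | succ m ih =>
    intro n hn T u hu
    obtain ⟨n, rfl⟩ : ∃ k, n = k + 1 := ⟨n - 1, by omega⟩
    obtain ⟨hL, hR⟩ := hasBottomRow_succ.1 hu
    have h1 := ih n (by omega) _ _ hL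
    have h2 := ih n (by omega) _ _ hR
    have h0 := graphEnergy_mono (u ∘ cellMap 0) (Nat.zero_le n)
    have hc := topConductance_pos m
    simp only [graphEnergy_zero, Function.comp_apply, cellMap_corner_self] at h0 h1 h2
    rw [cellMap_corner_comm 1 0] at h1
    rw [cellMap_corner_comm 2 0] at h2
    have key := triangleEnergy_complete_square hc (rowMean m T)
      (rowMean m fun k => T (k + 2 ^ m)) (u (cellMap 0 (corner 1))) (u (cellMap 0 (corner 2)))
      (u (corner 0))
    have s1 : 0 ≤ (topConductance m + 1) / 2 * (u (cellMap 0 (corner 1))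
      + u (cellMap 0 (corner 2)) - (topConductance m * (rowMean m T
      + rowMean m fun k => T (k + 2 ^ m)) + 2 * u (corner 0)) / (topConductance m + 1)) ^ 2 := by
      positivity
    have s2 : 0 ≤ (topConductance m + 3) / 2 * (u (cellMap 0 (corner 1))
      - u (cellMap 0 (corner 2)) - topConductance m * (rowMean m T
      - rowMean m fun k => T (k + 2 ^ m)) / (topConductance m + 3)) ^ 2 := by
      positivity
    have e : topConductance (m + 1) = 5 / 3 * (2 * topConductance m / (1 + topConductance m)) := by
      rw [topConductance]
      ring
    rw [graphEnergy_succ, Fin.sum_univ_three, rowEnergy, rowMean, e]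
    linarith

theorem exists_energy_eq (m : ℕ) : ∀ (T : ℕ → ℝ) (z : ℝ), ∃ u : C(sierpinskiGasket, ℝ),
    HasBottomRow m T u ∧ u (corner 0) = z ∧ ∀ n, m ≤ n →
      graphEnergy n u = rowEnergy m T + topConductance m * (z - rowMean m T) ^ 2 := by
  induction m with
  | zero =>
    intro T z
    obtain ⟨u, hu, hE⟩ := exists_harmonic_energy ![z, T 0, T 1]
    refine ⟨u, ?_, hu 0, fun n _ => ?_⟩
    · intro k
      fin_cases k
      · exact (congrArg u bottomPoint_zero_left).trans (hu 1)
      · exact (congrArg u bottomPoint_zero_right).trans (hu 2)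
    · rw [hE]
      simp [rowEnergy, topConductance, rowMean, triangleEnergy]
      ring
  | succ m ih =>
    intro T z
    set c := topConductance m with hc_def
    set p := rowMean m T with hp
    set q := rowMean m fun k => T (k + 2 ^ m) with hq
    -- These `x`, `y` solve the two linear equations that make both dropped squares vanish.
    set x := ((c * (p + q) + 2 * z) / (c + 1) + c * (p - q) / (c + 3)) / 2 with hx
    set y := ((c * (p + q) + 2 * z) / (c + 1) - c * (p - q) / (c + 3)) / 2 with hy
    have hc : 0 < c := topConductance_pos m
    obtain ⟨u₀, h₀, E₀⟩ := exists_harmonic_energy ![z, x, y]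
    obtain ⟨u₁, B₁, h₁, E₁⟩ := ih T x
    obtain ⟨u₂, B₂, h₂, E₂⟩ := ih (fun k => T (k + 2 ^ m)) y
    -- The lower cells meet at the midpoint of the row, where both pieces take the value `T (2 ^
    -- m)`.
    have h12 : u₁ (corner 2) = u₂ (corner 1) := by
      rw [← bottomPoint_last m, ← bottomPoint_first m, B₁, B₂]
      simp
    obtain ⟨u, hu⟩ := exists_glue ![u₀, u₁, u₂] (by
      have e1 := h₀ 1
      have e2 := h₀ 2
      intro i j
      fin_cases i <;> fin_cases j <;> simp_all)
    have c0 : u ∘ cellMap 0 = u₀ := funext fun x => hu 0 x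
    have c1 : u ∘ cellMap 1 = u₁ := funext fun x => hu 1 x
    have c2 : u ∘ cellMap 2 = u₂ := funext fun x => hu 2 x
    refine ⟨u, hasBottomRow_succ.2 ⟨c1 ▸ B₁, c2 ▸ B₂⟩, ?_, ?_⟩
    · rw [← cellMap_corner_self]
      exact (hu 0 _).trans (h₀ 0)
    · intro n hn
      obtain ⟨n, rfl⟩ : ∃ k, n = k + 1 := ⟨n - 1, by omega⟩
      have key := triangleEnergy_complete_square hc p q x y z
      have e1 : x + y - (c * (p + q) + 2 * z) / (c + 1) = 0 := by
        rw [hx, hy]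
        ring
      have e2 : x - y - c * (p - q) / (c + 3) = 0 := by
        rw [hx, hy]
        ring
      rw [e1, e2] at key
      have e : topConductance (m + 1) = 5 / 3 * (2 * c / (1 + c)) := by
        rw [topConductance]
        ring
      rw [graphEnergy_succ, Fin.sum_univ_three, c0, c1, c2, E₀, E₁ n (by omega),
        E₂ n (by omega), rowEnergy, rowMean, e, ← hp, ← hq, ← hc_def]
      simp only [Matrix.cons_val_zero, Matrix.cons_val_one, Matrix.cons_val]
      linarith

/-! ### Zero energy, parallelogram identity and first variation. -/

theorem eq_const_of_graphEnergy_eq_zero (n : ℕ) : ∀ v : sierpinskiGasket → ℝ,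
    (∀ k, graphEnergy k v = 0) → ∀ (w : Fin n → Fin 3) (i j : Fin 3),
      v (cellCorner w i) = v (corner j) := by
  have base : ∀ v : sierpinskiGasket → ℝ, (∀ k, graphEnergy k v = 0) → ∀ i j : Fin 3,
      v (corner i) = v (corner j) := by
    intro v hv
    have h := hv 0
    rw [graphEnergy_zero, triangleEnergy] at h
    have h0 : v (corner 0) - v (corner 1) = 0 := by
      apply pow_eq_zero_iff (two_ne_zero) |>.1
      nlinarith [sq_nonneg (v (corner 0) - v (corner 1)), sq_nonneg (v (corner 1) - v (corner 2)),
        sq_nonneg (v (corner 2) - v (corner 0))]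
    have h1 : v (corner 1) - v (corner 2) = 0 := by
      apply pow_eq_zero_iff (two_ne_zero) |>.1
      nlinarith [sq_nonneg (v (corner 0) - v (corner 1)), sq_nonneg (v (corner 1) - v (corner 2)),
        sq_nonneg (v (corner 2) - v (corner 0))]
    intro i j
    fin_cases i <;> fin_cases j <;> simp <;> linarith
  induction n with
  | zero =>
    intro v hv w i j
    rw [Subsingleton.elim w Fin.elim0]
    exact base v hv i j
  | succ n ih =>
    intro v hv w i j
    have hsub : ∀ l k, graphEnergy k (v ∘ cellMap l) = 0 := by
      intro l k
      have h := hv (k + 1)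
      rw [graphEnergy_succ] at h
      have h' : ∑ i, graphEnergy k (v ∘ cellMap i) = 0 := by linarith
      exact (Finset.sum_eq_zero_iff_of_nonneg fun i _ => graphEnergy_nonneg k _).1 h' l
        (Finset.mem_univ l)
    rw [← Fin.cons_self_tail w, cellCorner_cons]
    -- The corner `w 0` is fixed by `cellMap (w 0)`, which ties the constant on this cell to a
    -- corner of the whole gasket.
    have h := ih (v ∘ cellMap (w 0)) (hsub _) (Fin.tail w) i (w 0)
    simp only [Function.comp_apply, cellMap_corner_self] at h
    rw [h, base v hv]

theorem graphEnergy_parallelogram (n : ℕ) (u v : sierpinskiGasket → ℝ) :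
    graphEnergy n (fun x => (u x + v x) / 2) + graphEnergy n (fun x => u x - v x) / 4 =
      (graphEnergy n u + graphEnergy n v) / 2 := by
  simp only [graphEnergy, mul_div_assoc]
  rw [← mul_add, ← mul_add, mul_div_assoc]
  congr 1
  rw [← Finset.sum_add_distrib, Finset.sum_div, Finset.sum_div, ← Finset.sum_add_distrib]
  refine Finset.sum_congr rfl fun w _ => ?_
  ring

theorem continuousMap_ext_of_vertices {u v : C(sierpinskiGasket, ℝ)}
    (h : ∀ (n : ℕ) (w : Fin n → Fin 3) i, u (cellCorner w i) = v (cellCorner w i)) : u = v := by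
  have hd : Dense {x : sierpinskiGasket | (x : EuclideanSpace ℝ (Fin 2)) ∈
      ⋃ n, gasketVertices n} := by
    intro x
    rw [closure_subtype]
    refine closure_mono ?_ x.2
    intro y hy
    exact ⟨⟨y, subset_closure hy⟩, hy, rfl⟩
  refine DFunLike.coe_injective (Continuous.ext_on hd u.continuous v.continuous ?_)
  intro x hx
  obtain ⟨n, w, i, e⟩ := Set.mem_iUnion.1 hx
  have : x = cellCorner w i := Subtype.ext e
  rw [this]
  exact h n w i

open Classical in
/-- The graph Laplacian is the derivative of the graph energy in the direction of the indicator
function of a point. -/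
theorem graphEnergy_add_indicator (n : ℕ) (u : sierpinskiGasket → ℝ) (x : sierpinskiGasket)
    (s : ℝ) : graphEnergy n (fun y => u y + s * if y = x then 1 else 0) =
      graphEnergy n u - 2 * s * ((5 / 3) ^ n * graphLaplacian n u x)
        + s ^ 2 * graphEnergy n (fun y => if y = x then 1 else 0) := by
  have hL : graphLaplacian n u x = ∑ w : Fin n → Fin 3, ∑ i : Fin 3, ∑ j : Fin 3,
      (if cellCorner w i = x then 1 else 0) * (u (cellCorner w j) - u (cellCorner w i)) := by
    unfold graphLaplacian
    refine Finset.sum_congr rfl fun w _ => Finset.sum_congr rfl fun i _ =>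
      Finset.sum_congr rfl fun j _ => ?_
    split_ifs with h
    · rw [h, one_mul]
    · rw [zero_mul]
  rw [hL]
  simp only [graphEnergy]
  have : ∀ a b c r : ℝ, a * b - 2 * s * (a * c) + s ^ 2 * (a * r)
      = a * (b - 2 * s * c + s ^ 2 * r) := by
    intros
    ring
  rw [this, Finset.mul_sum (a := 2 * s), Finset.mul_sum (a := s ^ 2), ← Finset.sum_sub_distrib, ← Finset.sum_add_distrib]
  congr 1
  refine Finset.sum_congr rfl fun w _ => ?_
  simp only [Fin.sum_univ_three]
  ring

theorem graphLaplacian_eq_zero_of_le {n : ℕ} {u : sierpinskiGasket → ℝ} {x : sierpinskiGasket}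
    (h : ∀ v : sierpinskiGasket → ℝ, (∀ y, y ≠ x → v y = u y) →
      graphEnergy n u ≤ graphEnergy n v) : graphLaplacian n u x = 0 := by
  classical
  set A := (5 / 3 : ℝ) ^ n * graphLaplacian n u x with hA
  set B := graphEnergy n (fun y => if y = x then 1 else 0) with hB
  have hB0 : 0 ≤ B := graphEnergy_nonneg _ _
  have key : ∀ s : ℝ, 0 ≤ - 2 * s * A + s ^ 2 * B := by
    intro s
    have h1 := h (fun y => u y + s * if y = x then 1 else 0) (fun y hy => by simp [hy])
    rw [graphEnergy_add_indicator] at h1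
    linarith
  have hA0 : A = 0 := by
    -- A small step along the linear term; the denominator `B + 1` is positive even when `B = 0`.
    have h1 := key (A / (B + 1))
    have hb : 0 < B + 1 := by linarith
    have e : -2 * (A / (B + 1)) * A + (A / (B + 1)) ^ 2 * B
        = -(A ^ 2 * (B + 2)) / (B + 1) ^ 2 := by
      field_simp
      ring
    rw [e] at h1
    have h2 : 0 ≤ -(A ^ 2 * (B + 2)) := by
      by_contra hneg
      push Not at hneg
      exact absurd h1 (not_le.2 (div_neg_of_neg_of_pos hneg (by positivity)))
    have h3 : A ^ 2 = 0 := by nlinarith [sq_nonneg A]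
    exact pow_eq_zero_iff two_ne_zero |>.1 h3
  rcases mul_eq_zero.1 hA0 with h1 | h1
  · exact absurd h1 (by positivity)
  · exact h1

/-! ### Existence, uniqueness and harmonicity of the minimizer. -/

/-- The values on the bottom row, extended by zero to all indices. -/
noncomputable def extendRow (m : ℕ) (t : Fin (2 ^ m + 1) → ℝ) (k : ℕ) : ℝ :=
  if h : k < 2 ^ m + 1 then t ⟨k, h⟩ else 0

theorem extendRow_apply (m : ℕ) (t : Fin (2 ^ m + 1) → ℝ) (k : Fin (2 ^ m + 1)) :
    extendRow m t k = t k := by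
  rw [extendRow, dif_pos k.2]

section Minimizer

variable {m : ℕ} {t : Fin (2 ^ m + 1) → ℝ}

theorem hasBottomRow_extendRow {v : sierpinskiGasket → ℝ} (hv : ∀ k, v (bottomPoint m k) = t k) :
    HasBottomRow m (extendRow m t) v := fun k => (hv k).trans (extendRow_apply m t k).symm

theorem rowEnergy_le {v : sierpinskiGasket → ℝ} (hv : ∀ k, v (bottomPoint m k) = t k) {n : ℕ}
    (hn : m ≤ n) : rowEnergy m (extendRow m t) ≤ graphEnergy n v := by
  have h := rowEnergy_le_graphEnergy m n hn _ v (hasBottomRow_extendRow hv)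
  have := topConductance_pos m
  have h2 : 0 ≤ topConductance m * (v (corner 0) - rowMean m (extendRow m t)) ^ 2 := by positivity
  linarith

theorem ofReal_rowEnergy_le {v : C(sierpinskiGasket, ℝ)} (hv : ∀ k, v (bottomPoint m k) = t k) :
    ENNReal.ofReal (rowEnergy m (extendRow m t)) ≤ gasketEnergy v :=
  (ENNReal.ofReal_le_ofReal (rowEnergy_le hv le_rfl)).trans
    (le_iSup (fun n => ENNReal.ofReal (graphEnergy n v)) m)

theorem exists_gasketEnergy_eq (m : ℕ) (t : Fin (2 ^ m + 1) → ℝ) :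
    ∃ u : C(sierpinskiGasket, ℝ), (∀ k, u (bottomPoint m k) = t k) ∧
      gasketEnergy u = ENNReal.ofReal (rowEnergy m (extendRow m t)) := by
  obtain ⟨u, hu, -, hE⟩ := exists_energy_eq m (extendRow m t) (rowMean m (extendRow m t))
  have hu' : ∀ k, u (bottomPoint m k) = t k := fun k => (hu k).trans (extendRow_apply m t k)
  refine ⟨u, hu', le_antisymm (iSup_le fun n => ENNReal.ofReal_le_ofReal ?_)
    (ofReal_rowEnergy_le hu')⟩
  refine (graphEnergy_mono u (le_max_right m n)).trans (le_of_eq ?_)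
  simp [hE _ (le_max_left m n)]

theorem exists_isBottomRowMinimizer (m : ℕ) (t : Fin (2 ^ m + 1) → ℝ) :
    ∃ u : C(sierpinskiGasket, ℝ), IsBottomRowMinimizer m t u := by
  obtain ⟨u, hu, hE⟩ := exists_gasketEnergy_eq m t
  exact ⟨u, hu, hE ▸ ENNReal.ofReal_lt_top, fun v _ hv => hE ▸ ofReal_rowEnergy_le hv⟩

theorem IsBottomRowMinimizer.gasketEnergy_eq {u : C(sierpinskiGasket, ℝ)}
    (hu : IsBottomRowMinimizer m t u) :
    gasketEnergy u = ENNReal.ofReal (rowEnergy m (extendRow m t)) := by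
  obtain ⟨v, hv, hE⟩ := exists_gasketEnergy_eq m t
  exact le_antisymm (hE ▸ hu.minimal v (hE ▸ ENNReal.ofReal_lt_top) hv)
    (ofReal_rowEnergy_le hu.interpolates)

theorem IsBottomRowMinimizer.graphEnergy_eq {u : C(sierpinskiGasket, ℝ)}
    (hu : IsBottomRowMinimizer m t u) {n : ℕ} (hn : m ≤ n) :
    graphEnergy n u = rowEnergy m (extendRow m t) := by
  refine le_antisymm ?_ (rowEnergy_le hu.interpolates hn)
  rw [← ENNReal.ofReal_le_ofReal_iff (rowEnergy_nonneg _ _), ← hu.gasketEnergy_eq]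
  exact le_iSup (fun n => ENNReal.ofReal (graphEnergy n u)) n

/-- From level `m` on, the graph energy of `u` already equals the lower bound, and changing `u` at a
point off the row leaves the constraint intact. -/
theorem IsBottomRowMinimizer.isHarmonicOffBottomRow {u : C(sierpinskiGasket, ℝ)}
    (hu : IsBottomRowMinimizer m t u) : IsHarmonicOffBottomRow m u := by
  intro n hn x _ hx
  refine graphLaplacian_eq_zero_of_le fun v hv => ?_
  rw [hu.graphEnergy_eq hn]
  refine rowEnergy_le (fun k => ?_) hn
  rw [hv _ fun h => hx ⟨k, h⟩, hu.interpolates]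

/-- The midpoint of two minimizers is still admissible, so the parallelogram identity leaves no
energy for their difference. The difference is then constant on vertices, and it vanishes at the
first point of the row. -/
theorem IsBottomRowMinimizer.unique {u v : C(sierpinskiGasket, ℝ)}
    (hu : IsBottomRowMinimizer m t u) (hv : IsBottomRowMinimizer m t v) : u = v := by
  have hz : ∀ n, m ≤ n → graphEnergy n (fun x => u x - v x) ≤ 0 := by
    intro n hn
    have h1 := graphEnergy_parallelogram n u v
    have h2 : rowEnergy m (extendRow m t) ≤ graphEnergy n fun x => (u x + v x) / 2 :=
      rowEnergy_le (fun k => by rw [hu.interpolates, hv.interpolates]; ring) hn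
    rw [hu.graphEnergy_eq hn, hv.graphEnergy_eq hn] at h1
    linarith
  have hz' : ∀ n, graphEnergy n (fun x => u x - v x) = 0 := fun n =>
    le_antisymm ((graphEnergy_mono _ (le_max_right m n)).trans (hz _ (le_max_left m n)))
      (graphEnergy_nonneg _ _)
  refine continuousMap_ext_of_vertices fun n w i => ?_
  have h := eq_const_of_graphEnergy_eq_zero n _ hz' w i 1
  rw [← bottomPoint_first m, hu.interpolates, hv.interpolates, sub_self] at h
  linarith

end Minimizer

/-! ### Haar coefficients as differences of means. -/

/-- The integral over `[0, 1]` of a function that is constant on the open cells of the uniform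
grid of mesh `1 / N`. -/
theorem integral_of_eqOn_cells {F : ℝ → ℝ} {c : ℕ → ℝ} {N : ℕ} (hN : 0 < N)
    (h : ∀ j < N, ∀ x ∈ Set.Ioo ((j : ℝ) / N) ((j + 1 : ℝ) / N), F x = c j) :
    ∫ x in (0 : ℝ)..1, F x = (∑ j ∈ Finset.range N, c j) / N := by
  have hN' : (0 : ℝ) < N := by exact_mod_cast hN
  have hle : ∀ j : ℕ, (j : ℝ) / N ≤ ((j + 1 : ℕ) : ℝ) / N := fun j => by
    push_cast
    gcongr
    linarith
  have heq : ∀ j < N, (Set.Ioo ((j : ℝ) / N) (((j + 1 : ℕ) : ℝ) / N)).EqOn F fun _ => c j :=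
    fun j hj x hx => h j hj x (by exact_mod_cast hx)
  have hint : ∀ j < N, IntervalIntegrable F volume ((j : ℝ) / N) (((j + 1 : ℕ) : ℝ) / N) :=
    fun j hj => (intervalIntegrable_const (c := c j)).congr_uIoo (by
      rw [Set.uIoo_of_le (hle j)]
      exact (heq j hj).symm)
  have hsum := intervalIntegral.sum_integral_adjacent_intervals (a := fun j : ℕ => (j : ℝ) / N) hint
  simp only [Nat.cast_zero, zero_div, div_self hN'.ne'] at hsum
  rw [← hsum, Finset.sum_div]
  refine Finset.sum_congr rfl fun j hj => ?_
  rw [intervalIntegral.integral_congr_Ioo_of_le (hle j) (heq j (Finset.mem_range.1 hj)),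
    intervalIntegral.integral_const]
  push_cast
  rw [smul_eq_mul]
  field_simp
  ring

/-- The cell lies in `I_i` exactly when `2i - 1 ≤ j ≤ 2i`, that is, `i = (j + 1) / 2` with integer
division. Open cells avoid the endpoints where neighbouring intervals overlap. -/
theorem stepInterpolation_eq {m : ℕ} (t : Fin (2 ^ m + 1) → ℝ) {j : ℕ} (hj : j < 2 ^ (m + 1))
    {x : ℝ} (hx : x ∈ Set.Ioo ((j : ℝ) / (2 ^ (m + 1) : ℕ)) ((j + 1 : ℝ) / (2 ^ (m + 1) : ℕ))) :
    stepInterpolation m t x = extendRow m t ((j + 1) / 2) := by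
  have hN : (0 : ℝ) < 2 ^ (m + 1) := by positivity
  obtain ⟨h1, h2⟩ := hx
  push_cast at h1 h2
  have hx0 : 0 ≤ x := le_trans (by positivity) h1.le
  have hjN : (j : ℝ) + 1 ≤ 2 ^ (m + 1) := by exact_mod_cast hj
  have hx1 : x ≤ 1 := h2.le.trans ((div_le_one hN).2 hjN)
  rw [div_lt_iff₀ hN] at h1
  rw [lt_div_iff₀ hN] at h2
  have hb : (j + 1) / 2 < 2 ^ m + 1 := by
    rw [pow_succ] at hj
    omega
  rw [extendRow, dif_pos hb, stepInterpolation, Finset.sum_eq_single ⟨(j + 1) / 2, hb⟩]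
  · rw [Set.indicator_of_mem]
    refine ⟨⟨?_, ?_⟩, hx0, hx1⟩
    · rw [div_le_iff₀ hN]
      have : 2 * (((j + 1) / 2 : ℕ) : ℝ) ≤ j + 1 := by
        have : 2 * ((j + 1) / 2) ≤ j + 1 := by omega
        exact_mod_cast this
      simp only
      linarith
    · rw [le_div_iff₀ hN]
      have : (j : ℝ) ≤ 2 * (((j + 1) / 2 : ℕ) : ℝ) := by
        have : j ≤ 2 * ((j + 1) / 2) := by omega
        exact_mod_cast this
      simp only
      linarith
  · intro i _ hi
    refine Set.indicator_of_notMem (fun hmem => hi ?_) _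
    obtain ⟨h3, h4⟩ := hmem.1
    rw [div_le_iff₀ hN] at h3
    rw [le_div_iff₀ hN] at h4
    have h5 : 2 * (i : ℝ) < j + 2 := by linarith
    have h6 : (j : ℝ) < 2 * i + 1 := by linarith
    have h5' : 2 * (i : ℕ) < j + 2 := by exact_mod_cast h5
    have h6' : j < 2 * (i : ℕ) + 1 := by exact_mod_cast h6
    apply Fin.ext
    simp only
    omega
  · simp

theorem mem_Ico_iff_of_mem_cell {N j a b : ℕ} (hN : 0 < N) {x : ℝ}
    (hx : x ∈ Set.Ioo ((j : ℝ) / N) ((j + 1 : ℝ) / N)) :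
    (x ∈ Set.Ico ((a : ℝ) / N) ((b : ℝ) / N) ↔ j ∈ Finset.Ico a b) ∧
      (x ∈ Set.Ioc ((a : ℝ) / N) ((b : ℝ) / N) ↔ j ∈ Finset.Ico a b) := by
  have hN' : (0 : ℝ) < N := by exact_mod_cast hN
  obtain ⟨h1, h2⟩ := hx
  rw [div_lt_iff₀ hN'] at h1
  rw [lt_div_iff₀ hN'] at h2
  simp only [Set.mem_Ico, Set.mem_Ioc, Finset.mem_Ico, div_le_iff₀ hN', div_lt_iff₀ hN',
    le_div_iff₀ hN', lt_div_iff₀ hN']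
  have ha : a ≤ j → (a : ℝ) ≤ j := fun h => by exact_mod_cast h
  have ha' : ¬ a ≤ j → (j : ℝ) + 1 ≤ a := fun h => by
    have : j + 1 ≤ a := by omega
    exact_mod_cast this
  have hb : j < b → (j : ℝ) + 1 ≤ b := fun h => by
    have : j + 1 ≤ b := by omega
    exact_mod_cast this
  have hb' : ¬ j < b → (b : ℝ) ≤ j := fun h => by
    have : b ≤ j := by omega
    exact_mod_cast this
  by_cases hA : a ≤ j
  · have := ha hA
    by_cases hB : j < b
    · have := hb hB
      exact ⟨⟨fun _ => ⟨hA, hB⟩, fun _ => ⟨by linarith, by linarith⟩⟩,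
        ⟨fun _ => ⟨hA, hB⟩, fun _ => ⟨by linarith, by linarith⟩⟩⟩
    · have := hb' hB
      exact ⟨⟨fun h => by linarith [h.2], fun h => absurd h.2 hB⟩,
        ⟨fun h => by linarith [h.2], fun h => absurd h.2 hB⟩⟩
  · have := ha' hA
    exact ⟨⟨fun h => by linarith [h.1], fun h => absurd h.1 hA⟩,
      ⟨fun h => by linarith [h.1], fun h => absurd h.1 hA⟩⟩

theorem haarFun_eq {m i k j : ℕ} (hi : i ≤ m) {x : ℝ}
    (hx : x ∈ Set.Ioo ((j : ℝ) / (2 ^ (m + 1) : ℕ)) ((j + 1 : ℝ) / (2 ^ (m + 1) : ℕ))) :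
    haarFun (m - i) k x = (2 : ℝ) ^ (((m - i : ℕ) : ℝ) / 2) *
      ((if j ∈ Finset.Ico (k * 2 ^ (i + 1)) (k * 2 ^ (i + 1) + 2 ^ i) then 1 else 0)
        - if j ∈ Finset.Ico (k * 2 ^ (i + 1) + 2 ^ i) (k * 2 ^ (i + 1) + 2 ^ i + 2 ^ i)
          then 1 else 0) := by
  have hN : 0 < 2 ^ (m + 1) := by positivity
  obtain ⟨n, rfl⟩ : ∃ n, m = n + i := ⟨m - i, by omega⟩
  rw [Nat.add_sub_cancel]
  have e1 : (k : ℝ) / 2 ^ n = ((k * 2 ^ (i + 1) : ℕ) : ℝ) / (2 ^ (n + i + 1) : ℕ) := by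
    push_cast
    field_simp
    ring
  have e2 : ((k : ℝ) + 1 / 2) / 2 ^ n
      = ((k * 2 ^ (i + 1) + 2 ^ i : ℕ) : ℝ) / (2 ^ (n + i + 1) : ℕ) := by
    push_cast
    field_simp
    ring
  have e3 : ((k : ℝ) + 1) / 2 ^ n
      = ((k * 2 ^ (i + 1) + 2 ^ i + 2 ^ i : ℕ) : ℝ) / (2 ^ (n + i + 1) : ℕ) := by
    push_cast
    field_simp
    ring
  rw [haarFun, e1, e2, e3]
  simp only [(mem_Ico_iff_of_mem_cell hN hx).1, (mem_Ico_iff_of_mem_cell hN hx).2]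
  by_cases h1 : j ∈ Finset.Ico (k * 2 ^ (i + 1)) (k * 2 ^ (i + 1) + 2 ^ i)
  · have h2 : j ∉ Finset.Ico (k * 2 ^ (i + 1) + 2 ^ i) (k * 2 ^ (i + 1) + 2 ^ i + 2 ^ i) := by
      rw [Finset.mem_Ico] at h1 ⊢
      omega
    rw [if_pos h1, if_pos h1, if_neg h2]
    ring
  · rw [if_neg h1, if_neg h1]
    split_ifs <;> ring

theorem haarCoeff_eq_sum {m i k : ℕ} (hi : i ≤ m) (hk : k < 2 ^ (m - i))
    (t : Fin (2 ^ m + 1) → ℝ) :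
    haarCoeff m (m - i) k t = (2 : ℝ) ^ (((m - i : ℕ) : ℝ) / 2) *
      (∑ j ∈ Finset.range (2 ^ i), extendRow m t ((k * 2 ^ (i + 1) + j + 1) / 2)
        - ∑ j ∈ Finset.range (2 ^ i), extendRow m t ((k * 2 ^ (i + 1) + 2 ^ i + j + 1) / 2))
        / 2 ^ (m + 1) := by
  have hN : 0 < 2 ^ (m + 1) := by positivity
  rw [haarCoeff, integral_of_eqOn_cells hN fun j hj x hx => by
    rw [haarFun_eq hi hx, stepInterpolation_eq t hj hx]]
  push_cast
  congr 1
  simp only [mul_assoc, ← Finset.mul_sum, sub_mul, ite_mul, one_mul, zero_mul,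
    Finset.sum_sub_distrib, Finset.sum_ite_mem]
  -- The support of the Haar function stays inside `[0, 1]`, so restricting to the grid loses no
  -- term.
  have hle : k * 2 ^ (i + 1) + 2 ^ i + 2 ^ i ≤ 2 ^ (m + 1) := by
    calc k * 2 ^ (i + 1) + 2 ^ i + 2 ^ i = (k + 1) * 2 ^ (i + 1) := by ring
      _ ≤ 2 ^ (m - i) * 2 ^ (i + 1) := Nat.mul_le_mul_right _ hk
      _ = 2 ^ (m + 1) := by
        rw [← pow_add]
        congr 1
        omega
  have hpos : 0 < 2 ^ i := by positivity
  rw [Finset.inter_eq_right.2, Finset.inter_eq_right.2, Finset.sum_Ico_eq_sum_range,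
    Finset.sum_Ico_eq_sum_range, Nat.add_sub_cancel_left, Nat.add_sub_cancel_left]
  · intro j hj
    rw [Finset.mem_Ico] at hj
    rw [Finset.mem_range]
    omega
  · intro j hj
    rw [Finset.mem_Ico] at hj
    rw [Finset.mem_range]
    omega

/-- The index `(j + 1) / 2` takes each inner value twice and the two end values once: these are the
trapezoidal weights. -/
theorem rowMean_eq_sum (i : ℕ) (T : ℕ → ℝ) :
    rowMean i T = (∑ j ∈ Finset.range (2 ^ (i + 1)), T ((j + 1) / 2)) / 2 ^ (i + 1) := by
  induction i generalizing T with
  | zero => simp [rowMean, Finset.sum_range_succ]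
  | succ i ih =>
    rw [rowMean, ih, ih, pow_succ 2 (i + 1), mul_two, Finset.sum_range_add]
    have e : ∀ j, (2 ^ (i + 1) + j + 1) / 2 = (j + 1) / 2 + 2 ^ i := by
      intro j
      rw [pow_succ]
      omega
    simp only [e]
    rw [pow_succ (2 : ℝ) (i + 1)]
    field_simp

/-- The difference of the means over the two halves of a row of `2 ^ i + 1` values (of the two
values for `i = 0`). -/
noncomputable def rowDiff : ℕ → (ℕ → ℝ) → ℝ
  | 0, T => T 0 - T 1
  | i + 1, T => rowMean i T - rowMean i fun k => T (k + 2 ^ i)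

theorem sum_sub_sum_eq_rowDiff (i k : ℕ) (T : ℕ → ℝ) :
    ∑ j ∈ Finset.range (2 ^ i), T ((k * 2 ^ (i + 1) + j + 1) / 2)
      - ∑ j ∈ Finset.range (2 ^ i), T ((k * 2 ^ (i + 1) + 2 ^ i + j + 1) / 2)
      = 2 ^ i * rowDiff i fun l => T (l + k * 2 ^ i) := by
  cases i with
  -- At the finest scale each half of the support is one grid cell and sees a single value, hence
  -- the separate base case of `rowDiff`.
  | zero =>
    have e1 : (k * 2 + 1) / 2 = k := by omega
    have e2 : (k * 2 + 1 + 1) / 2 = 1 + k := by omega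
    simp [rowDiff, e1, e2]
  | succ i =>
    rw [rowDiff, rowMean_eq_sum, rowMean_eq_sum]
    have e1 : ∀ j, (k * 2 ^ (i + 1 + 1) + j + 1) / 2 = (j + 1) / 2 + k * 2 ^ (i + 1) := by
      intro j
      rw [pow_succ 2 (i + 1), ← mul_assoc]
      omega
    have e2 : ∀ j, (k * 2 ^ (i + 1 + 1) + 2 ^ (i + 1) + j + 1) / 2
        = (j + 1) / 2 + 2 ^ i + k * 2 ^ (i + 1) := by
      intro j
      rw [pow_succ 2 (i + 1), ← mul_assoc]
      generalize k * 2 ^ (i + 1) = b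
      rw [pow_succ]
      omega
    simp only [e1, e2]
    field_simp

theorem haarCoeff_sq {m i k : ℕ} (hi : i ≤ m) (hk : k < 2 ^ (m - i))
    (t : Fin (2 ^ m + 1) → ℝ) :
    haarCoeff m (m - i) k t ^ 2 =
      (rowDiff i fun l => extendRow m t (l + k * 2 ^ i)) ^ 2 / (4 * 2 ^ (m - i)) := by
  rw [haarCoeff_eq_sum hi hk, sum_sub_sum_eq_rowDiff]
  have h : ((2 : ℝ) ^ (((m - i : ℕ) : ℝ) / 2)) ^ 2 = 2 ^ (m - i) := by
    rw [← Real.rpow_natCast, ← Real.rpow_mul (by norm_num), ← Real.rpow_natCast]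
    congr 1
    push_cast
    ring
  have e : (2 : ℝ) ^ (m + 1) = 2 * (2 ^ (m - i) * 2 ^ i) := by
    rw [← pow_add, Nat.sub_add_cancel hi, pow_succ]
    ring
  rw [div_pow, mul_pow, h, e]
  field_simp
  ring

/-! ### The energy in Haar coordinates and the constants. -/

/-- The coefficient of the differences at scale `i` in the row energy. -/
noncomputable def scaleWeight : ℕ → ℝ
  | 0 => 3 / 2
  | i + 1 => 5 / 3 * (3 * topConductance i / (6 + 2 * topConductance i))

theorem rowEnergy_eq_sum (m : ℕ) (T : ℕ → ℝ) :
    rowEnergy m T = ∑ i ∈ Finset.range (m + 1), (5 / 3) ^ (m - i) * scaleWeight i *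
      ∑ k ∈ Finset.range (2 ^ (m - i)), (rowDiff i fun l => T (l + k * 2 ^ i)) ^ 2 := by
  induction m generalizing T with
  | zero => simp [rowEnergy, rowDiff, scaleWeight]
  | succ m ih =>
    rw [Finset.sum_range_succ, rowEnergy, ih, ih, mul_add, mul_add, Finset.mul_sum,
      Finset.mul_sum, ← Finset.sum_add_distrib]
    congr 1
    · refine Finset.sum_congr rfl fun i hi => ?_
      have him : i ≤ m := Nat.lt_succ_iff.1 (Finset.mem_range.1 hi)
      have e : m + 1 - i = m - i + 1 := by omega
      have es : ∀ l k, l + k * 2 ^ i + 2 ^ m = l + (2 ^ (m - i) + k) * 2 ^ i := by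
        intro l k
        rw [add_mul, ← pow_add, Nat.sub_add_cancel him]
        ring
      rw [e, pow_succ 2 (m - i), mul_two, Finset.sum_range_add, pow_succ]
      simp only [es]
      ring
    · simp [rowDiff, scaleWeight]
      ring

/-- The reciprocals satisfy the affine recursion `r ↦ 3/10 * (1 + r)` with fixed point 3/7, so they
equal `3/7 + (3/10) ^ m / 14`. -/
theorem topConductance_eq (m : ℕ) :
    topConductance m = 14 * 10 ^ m / (6 * 10 ^ m + 3 ^ m) := by
  induction m with
  | zero => norm_num [topConductance]
  | succ m ih =>
    rw [topConductance, ih, pow_succ, pow_succ]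
    have h1 : (0 : ℝ) < 10 ^ m := by positivity
    have h2 : (0 : ℝ) < 3 ^ m := by positivity
    generalize (10 : ℝ) ^ m = X at *
    generalize (3 : ℝ) ^ m = Y at *
    field_simp
    ring

/-- The coefficient of the Haar coefficients at scale `i` in the energy of the minimizer. -/
noncomputable def haarWeight (m i : ℕ) : ℝ := (10 / 3) ^ (m - i) * (4 * scaleWeight i)

/-- The formula needs `1 ≤ m`: the base weight `scaleWeight 0` is a separate value and gives 6 at `m
= 0`, not 10/3. -/
theorem haarWeight_self (m : ℕ) (hm : 1 ≤ m) :
    haarWeight m m = 70 * 10 ^ m / (5 * 3 ^ m + 16 * 10 ^ m) := by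
  obtain ⟨m, rfl⟩ : ∃ k, m = k + 1 := ⟨m - 1, by omega⟩
  rw [haarWeight, Nat.sub_self, pow_zero, one_mul, scaleWeight, topConductance_eq, pow_succ,
    pow_succ]
  have h1 : (0 : ℝ) < 10 ^ m := by positivity
  have h2 : (0 : ℝ) < 3 ^ m := by positivity
  generalize (10 : ℝ) ^ m = X at *
  generalize (3 : ℝ) ^ m = Y at *
  field_simp
  ring

theorem rowEnergy_eq_haar (m : ℕ) (t : Fin (2 ^ m + 1) → ℝ) :
    rowEnergy m (extendRow m t) = ∑ i ∈ Finset.range (m + 1), haarWeight m i *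
      ∑ j ∈ Finset.range (2 ^ (m - i)), haarCoeff m (m - i) j t ^ 2 := by
  rw [rowEnergy_eq_sum]
  refine Finset.sum_congr rfl fun i hi => ?_
  have him : i ≤ m := Nat.lt_succ_iff.1 (Finset.mem_range.1 hi)
  rw [Finset.sum_congr rfl fun k hk => haarCoeff_sq him (Finset.mem_range.1 hk) t,
    ← Finset.sum_div, haarWeight]
  -- Each subdivision contributes 5/3 from the energy and 2 from the normalization in
  -- `haarCoeff_sq`.
  have e : (10 / 3 : ℝ) ^ (m - i) = 2 ^ (m - i) * (5 / 3) ^ (m - i) := by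
    rw [← mul_pow]
    norm_num
  rw [e]
  field_simp

theorem mainTheorem5 :
    ∃ γ : ℕ → ℕ → ℝ,
      γ 1 0 = 20 ∧
      (∀ m n : ℕ, 2 ≤ m → n < m → γ m n = 10 / 3 * γ (m - 1) n) ∧
      (∀ m : ℕ, 1 ≤ m → γ m m = 70 * 10 ^ m / (5 * 3 ^ m + 16 * 10 ^ m)) ∧
      ∀ (m : ℕ), 1 ≤ m → ∀ t : Fin (2 ^ m + 1) → ℝ,
        (∃! u : C(sierpinskiGasket, ℝ), IsBottomRowMinimizer m t u) ∧
        ∀ u : C(sierpinskiGasket, ℝ), IsBottomRowMinimizer m t u →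
          IsHarmonicOffBottomRow m u ∧
          gasketEnergy u = ENNReal.ofReal
            (∑ i ∈ Finset.range (m + 1), γ m i *
              ∑ j ∈ Finset.range (2 ^ (m - i)), haarCoeff m (m - i) j t ^ 2) := by
  refine ⟨haarWeight, by norm_num [haarWeight, scaleWeight], ?_, haarWeight_self, ?_⟩
  · intro m n _ hn
    have e : m - n = m - 1 - n + 1 := by omega
    rw [haarWeight, haarWeight, e, pow_succ]
    ring
  · intro m _ t
    obtain ⟨u, hu⟩ := exists_isBottomRowMinimizer m t
    refine ⟨⟨u, hu, fun v hv => hv.unique hu⟩, fun v hv => ⟨hv.isHarmonicOffBottomRow, ?_⟩⟩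
    rw [hv.gasketEnergy_eq, rowEnergy_eq_haar]
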